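/- Let $q\ge 2$ be an integer and $\Sigma_q=\{0,1,\dots,q-1\}$. For a word $x$ over $\Sigma_q$ let $\mathcal B^{\mathrm D}_q(x)$ (respectively $\mathcal B^{\mathrm I}_q(x)$) be the set of all words obtained from $x$ by exactly one deletion (respectively exactly one insertion) of a symbol, and let $B\in\{\mathcal B^{\mathrm D}_q,\mathcal B^{\mathrm I}_q\}$. For a code $\mathcal C\subseteq\Sigma_q^n$ put $$\nu(\mathcal C;B)=\max\{|B(x)\cap B(y)| : x,y\in\mathcal C,\ x\neq y\}$$ (with $\max\varnothing=0$); $\mathcal C$ is an $(n,N;B)$-reconstruction code if $\nu(\mathcal C;B)<N$. For $N\ge 1$ let $$\rho(n,N;B)=\min\{\,n-\log_q|\mathcal C| : \varnothing\ne\mathcal C\subseteq\Sigma_q^n,\ \nu(\mathcal C;B)<N\,\}.$$ Here "$\rho=f(n)+\Theta(1)$" means that $f(n)-\epsilon(n)\le\rho\le f(n)+\epsilon(n)$ for some function $\epsilon(n)=\Theta(1)$, which may depend on $q$ and $B$. Then $$\rho(n,N;B)=\begin{cases}\log_q n+\Theta(1), & N=1 \ (n\ge 1),\\ \log_q\log_q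 n+\Theta(1), & N=2\ (n\ge 2),\\ 0, & N\ge 3\ (n\ge 0).\end{cases}$$ Moreover, call two words $x,y\in\Sigma_q^n$ Type-A-confusable if $x=acb$ and $y=a\overline{c}b$ for some words $a,b,c$, where $c=(\alpha\beta)^m$ or $c=(\alpha\beta)^m\alpha$ for some $m\ge1$ and $\alpha\ne\beta$ in $\Sigma_q$, and $\overline c$ is obtained from $c$ by exchanging $\alpha$ and $\beta$. Then no $(n,2;B)$-reconstruction code contains two distinct Type-A-confusable words, and there is a function $\epsilon(n)=\Theta(1)$, depending only on $q$, such that for all $n\ge2$ every nonempty $\mathcal C\subseteq\Sigma_q^n$ in which no two distinct words are Type-A-confusable satisfies $n-\log_q|\mathcal C|\ge\log_q\log_q n-\epsilon(n)$. -/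

import Mathlib

open Filter Asymptotics

namespace Reconstruction

/-- A word over the alphabet `Σ_q = Fin q` is a list. The words obtained from `x` by exactly one
deletion. -/
def deletionBall {q : ℕ} (x : List (Fin q)) : Finset (List (Fin q)) :=
  (Finset.range x.length).image (fun i => x.eraseIdx i)

/-- The words obtained from `x` by exactly one insertion of a symbol `s`, before position `i` or,
if `i = x.length`, at the end. -/
def insertionBall {q : ℕ} (x : List (Fin q)) : Finset (List (Fin q)) :=
  (Finset.range (x.length + 1) ×ˢ (Finset.univ : Finset (Fin q))).image
    (fun p => x.insertIdx p.1 p.2)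

/-- The read coverage `ν(C; B)`: the largest `|B(x) ∩ B(y)|` over pairs of distinct codewords
(`0` if there is no such pair). -/
def readCoverage {q : ℕ} (B : List (Fin q) → Finset (List (Fin q)))
    (C : Finset (List (Fin q))) : ℕ :=
  C.offDiag.sup (fun p => (B p.1 ∩ B p.2).card)

/-- `C ⊆ Σ_q^n`. -/
def IsCode {q : ℕ} (n : ℕ) (C : Finset (List (Fin q))) : Prop :=
  ∀ x ∈ C, x.length = n

/-- `C` is an `(n, N; B)`-reconstruction code. -/
def IsReconstructionCode {q : ℕ} (n N : ℕ) (B : List (Fin q) → Finset (List (Fin q)))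
    (C : Finset (List (Fin q))) : Prop :=
  IsCode n C ∧ readCoverage B C < N

/-- The redundancy `n - log_q |C|` of a nonempty code of length `n`. -/
noncomputable def codeRedundancy {q : ℕ} (n : ℕ) (C : Finset (List (Fin q))) : ℝ :=
  (n : ℝ) - Real.logb (q : ℝ) (C.card : ℝ)

/-- The optimal redundancy `ρ(n, N; B)`. The empty code, whose redundancy is infinite, is left
out. For `N ≥ 1` and `q ≥ 1` the infimum is a minimum, see `rho_isLeast`. -/
noncomputable def rho {q : ℕ} (n N : ℕ) (B : List (Fin q) → Finset (List (Fin q))) : ℝ :=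
  sInf {r : ℝ | ∃ C : Finset (List (Fin q)),
    C.Nonempty ∧ IsReconstructionCode n N B C ∧ r = codeRedundancy n C}

theorem rho_isLeast {q n N : ℕ} (hq : 1 ≤ q) (hN : 1 ≤ N)
    (B : List (Fin q) → Finset (List (Fin q))) :
    IsLeast {r : ℝ | ∃ C : Finset (List (Fin q)),
      C.Nonempty ∧ IsReconstructionCode n N B C ∧ r = codeRedundancy n C} (rho n N B) := by
  have hfin : {r : ℝ | ∃ C : Finset (List (Fin q)),
      C.Nonempty ∧ IsReconstructionCode n N B C ∧ r = codeRedundancy n C}.Finite := by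
    have hw : {x : List (Fin q) | x.length = n}.Finite := List.finite_length_eq (Fin q) n
    refine ((hw.toFinset.powerset).finite_toSet.image (codeRedundancy n)).subset ?_
    rintro r ⟨C, -, hC, rfl⟩
    refine ⟨C, ?_, rfl⟩
    simp only [Finset.coe_powerset, Set.mem_preimage, Set.mem_powerset_iff]
    intro x hx
    simpa using hC.1 x hx
  have hne : {r : ℝ | ∃ C : Finset (List (Fin q)),
      C.Nonempty ∧ IsReconstructionCode n N B C ∧ r = codeRedundancy n C}.Nonempty := by
    refine ⟨_, {List.replicate n ⟨0, hq⟩}, by simp, ⟨?_, ?_⟩, rfl⟩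
    · intro x hx
      simp only [Finset.mem_singleton] at hx
      simp [hx]
    · simpa [readCoverage] using Nat.lt_of_lt_of_le Nat.zero_lt_one hN
  exact ⟨hne.csInf_mem hfin, fun r hr => csInf_le hfin.bddBelow hr⟩

/-- The word `w^m`. -/
def wordPow {q : ℕ} (w : List (Fin q)) (m : ℕ) : List (Fin q) :=
  (List.replicate m w).flatten

/-- `x` and `y` are Type-A-confusable: `x = a c b` and `y = a c̄ b`, where `c` is `(st)^m` or
`(st)^m s` for some `m ≥ 1` and symbols `s ≠ t`, and `c̄` is `c` with `s` and `t` exchanged. -/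
def TypeAConfusable {q : ℕ} (x y : List (Fin q)) : Prop :=
  ∃ (a b c : List (Fin q)) (s t : Fin q) (m : ℕ), s ≠ t ∧ 1 ≤ m ∧
    (c = wordPow [s, t] m ∨ c = wordPow [s, t] m ++ [s]) ∧
    x = a ++ c ++ b ∧ y = a ++ c.map (Equiv.swap s t) ++ b

/-- No two distinct words of `C` are Type-A-confusable. -/
def TypeAFree {q : ℕ} (C : Finset (List (Fin q))) : Prop :=
  ∀ x ∈ C, ∀ y ∈ C, x ≠ y → ¬ TypeAConfusable x y

end Reconstruction

/-!
Every bound comes with an explicit constant, so all functions `ε` below are constant.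

*Intersections.* If `x` and `y` first differ in `x = a s u` and `y = a t v`, a common word of the
two balls starts with `a`, and its next symbol cannot be both `s` and `t`. Only two candidates
remain, `a u` and `a v` for deletions, `a t s u` and `a s t v` for insertions; this is the case
`N ≥ 3`. If both candidates are common, peeling off symbols shows that `x` and `y` differ by flipping
an alternating segment (`IsAltFlip`). Conversely, flipping one of length at least two gives two
common words.

*One read.* Both kinds of balls of `x ≠ y` meet exactly if `y` arises from `x` by a shift
(`IsShift`), up to exchanging `x` and `y`. So the insertion balls of the codewords are disjoint; each
has at least `n` elements among `q ^ (n + 1)` words, which is the lower bound. The upper bound is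
Tenengolts' code, a largest class of words under an invariant with `2 q n` values. Words in the same
class that are related by a shift have ascent words so related, and these are equal by the
Varshamov–Tenengolts argument; then the shifted symbol lies in a monotone run that starts and ends
with it, which must be constant.

*Two reads, lower bound.* The `k + 1` words `(t s)^j (s t)^(k-j)` of length `2 k` are pairwise
Type-A-confusable in any context. Cut words of length `n` into blocks of length `2 k`, about half of
`log_q n`. The words without such a block have density exponentially small in `k`. The remaining
words, grouped by the first such block, fall into classes of `k + 1` words of which a code contains
at most one. This gives density `O(1 / log_q n)`; see `card_le_of_typeAFree`.

*Two reads, upper bound.* At least half of all words have no alternating segment of length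
`m = ⌊log_q n⌋ + 4`. On these, the symbol sum modulo `q` and the weighted sum modulo `q m` separate
any two words that differ by an alternating flip, so that a largest class under these `q² m` values
is a code for two reads; see `rho_two_le`.
-/

namespace Reconstruction

variable {q : ℕ}

/-! ### Deletion and insertion balls -/

theorem mem_deletionBall_iff {x z : List (Fin q)} :
    z ∈ deletionBall x ↔ ∃ a s b, x = a ++ s :: b ∧ z = a ++ b := by
  simp only [deletionBall, Finset.mem_image, Finset.mem_range]
  constructor
  · rintro ⟨i, hi, rfl⟩
    refine ⟨x.take i, x[i], x.drop (i + 1), ?_, List.eraseIdx_eq_take_drop_succ x i⟩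
    rw [List.getElem_cons_drop, List.take_append_drop]
  · rintro ⟨a, s, b, rfl, rfl⟩
    exact ⟨a.length, by simp, by simp [List.eraseIdx_append_of_length_le]⟩

theorem insertIdx_length_append {α : Type*} (a b : List α) (s : α) :
    (a ++ b).insertIdx a.length s = a ++ s :: b := by
  induction a with
  | nil => simp
  | cons c a ih => simp [ih]

theorem mem_insertionBall_iff {x z : List (Fin q)} :
    z ∈ insertionBall x ↔ ∃ a s b, x = a ++ b ∧ z = a ++ s :: b := by
  simp only [insertionBall, Finset.mem_image, Finset.mem_product, Finset.mem_range,
    Finset.mem_univ, and_true, Prod.exists]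
  constructor
  · rintro ⟨i, s, hi, rfl⟩
    refine ⟨x.take i, s, x.drop i, (List.take_append_drop i x).symm, ?_⟩
    have h := insertIdx_length_append (x.take i) (x.drop i) s
    rwa [List.take_append_drop, List.length_take_of_le (by omega)] at h
  · rintro ⟨a, s, b, rfl, rfl⟩
    exact ⟨a.length, s, by simp, insertIdx_length_append a b s⟩

theorem mem_deletionBall_cons {c : Fin q} {x z : List (Fin q)} :
    z ∈ deletionBall (c :: x) ↔ z = x ∨ ∃ z', z = c :: z' ∧ z' ∈ deletionBall x := by
  simp only [mem_deletionBall_iff]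
  constructor
  · rintro ⟨_ | ⟨d, a⟩, s, b, h, rfl⟩
    · simp at h; simp [h]
    · simp only [List.cons_append, List.cons.injEq] at h
      obtain ⟨rfl, rfl⟩ := h
      exact Or.inr ⟨a ++ b, rfl, a, s, b, rfl, rfl⟩
  · rintro (rfl | ⟨_, rfl, a, s, b, rfl, rfl⟩)
    · exact ⟨[], c, z, rfl, rfl⟩
    · exact ⟨c :: a, s, b, rfl, rfl⟩

theorem mem_insertionBall_cons {c : Fin q} {x z : List (Fin q)} :
    z ∈ insertionBall (c :: x) ↔
      (∃ s, z = s :: c :: x) ∨ ∃ z', z = c :: z' ∧ z' ∈ insertionBall x := by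
  simp only [mem_insertionBall_iff]
  constructor
  · rintro ⟨_ | ⟨d, a⟩, s, b, h, rfl⟩
    · exact Or.inl ⟨s, by simpa using h.symm⟩
    · simp only [List.cons_append, List.cons.injEq] at h
      obtain ⟨rfl, rfl⟩ := h
      exact Or.inr ⟨a ++ s :: b, rfl, a, s, b, rfl, rfl⟩
  · rintro (⟨s, rfl⟩ | ⟨_, rfl, a, s, b, rfl, rfl⟩)
    · exact ⟨[], s, c :: x, rfl, rfl⟩
    · exact ⟨c :: a, s, b, rfl, rfl⟩

theorem length_le_card_insertionBall (hq : 2 ≤ q) (x : List (Fin q)) :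
    x.length ≤ (insertionBall x).card := by
  induction x with
  | nil => simp
  | cons c x ih =>
    have : Nontrivial (Fin q) := Fin.nontrivial_iff_two_le.2 hq
    obtain ⟨d, hd⟩ := exists_ne c
    have hsub : insert (d :: c :: x) ((insertionBall x).image (List.cons c)) ⊆
        insertionBall (c :: x) := by
      intro z hz
      rw [mem_insertionBall_cons]
      simp only [Finset.mem_insert, Finset.mem_image] at hz
      rcases hz with rfl | ⟨z', hz', rfl⟩
      · exact Or.inl ⟨d, rfl⟩
      · exact Or.inr ⟨z', rfl, hz'⟩
    have hnot : d :: c :: x ∉ (insertionBall x).image (List.cons c) := by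
      simp [hd.symm]
    have := Finset.card_le_card hsub
    rw [Finset.card_insert_of_notMem hnot,
      Finset.card_image_of_injective _ List.cons_injective] at this
    simp only [List.length_cons]
    omega

/-! ### Shifts -/

/-- `y` arises from `x` by deleting a symbol `s` and inserting a symbol `t` to the right of it:
`x = a s w b` and `y = a w t b`. -/
def IsShift (x y : List (Fin q)) : Prop :=
  ∃ (a w b : List (Fin q)) (s t : Fin q), x = a ++ s :: (w ++ b) ∧ y = a ++ (w ++ t :: b)

theorem IsShift.exists_mem_deletionBall {x y : List (Fin q)} (h : IsShift x y) :
    ∃ z, z ∈ deletionBall x ∧ z ∈ deletionBall y := by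
  obtain ⟨a, w, b, s, t, rfl, rfl⟩ := h
  exact ⟨a ++ (w ++ b), mem_deletionBall_iff.2 ⟨a, s, w ++ b, rfl, rfl⟩,
    mem_deletionBall_iff.2 ⟨a ++ w, t, b, by simp, by simp⟩⟩

theorem isShift_or_isShift_of_mem_deletionBall {x y z : List (Fin q)}
    (hx : z ∈ deletionBall x) (hy : z ∈ deletionBall y) : IsShift x y ∨ IsShift y x := by
  obtain ⟨a, s, b, rfl, rfl⟩ := mem_deletionBall_iff.1 hx
  obtain ⟨a', t, b', rfl, h⟩ := mem_deletionBall_iff.1 hy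
  rcases List.append_eq_append_iff.1 h with ⟨w, rfl, rfl⟩ | ⟨w, rfl, rfl⟩
  · exact Or.inl ⟨a, w, b', s, t, rfl, by simp⟩
  · exact Or.inr ⟨a', w, b, t, s, rfl, by simp⟩

theorem isShift_or_isShift_of_mem_insertionBall {x y z : List (Fin q)} (hne : x ≠ y)
    (hx : z ∈ insertionBall x) (hy : z ∈ insertionBall y) : IsShift x y ∨ IsShift y x := by
  obtain ⟨a, s, b, rfl, rfl⟩ := mem_insertionBall_iff.1 hx
  obtain ⟨a', t, b', rfl, h⟩ := mem_insertionBall_iff.1 hy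
  rcases List.append_eq_append_iff.1 h with ⟨w, rfl, hw⟩ | ⟨w, rfl, hw⟩
  · rcases w with _ | ⟨c, w⟩
    · simp only [List.nil_append, List.cons.injEq] at hw
      exact absurd (by simp [hw.2]) hne
    · simp only [List.cons_append, List.cons.injEq] at hw
      obtain ⟨rfl, rfl⟩ := hw
      exact Or.inr ⟨a, w, b', s, t, by simp, by simp⟩
  · rcases w with _ | ⟨c, w⟩
    · simp only [List.nil_append, List.cons.injEq] at hw
      exact absurd (by simp [hw.2]) hne
    · simp only [List.cons_append, List.cons.injEq] at hw
      obtain ⟨rfl, rfl⟩ := hw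
      exact Or.inl ⟨a', w, b, t, s, by simp, by simp⟩

/-! ### Alternating words and intersections of two balls -/

/-- The alternating word `s t s t …` of length `n`. -/
def alt : Fin q → Fin q → ℕ → List (Fin q)
  | _, _, 0 => []
  | s, t, n + 1 => s :: alt t s n

theorem alt_succ_eq_append (s t : Fin q) (n : ℕ) : ∃ p, alt s t (n + 1) = alt s t n ++ [p] := by
  induction n generalizing s t with
  | zero => exact ⟨s, rfl⟩
  | succ n ih =>
    obtain ⟨p, hp⟩ := ih t s
    exact ⟨p, by rw [alt, hp]; rfl⟩

theorem alt_add (s t : Fin q) (m n : ℕ) : ∃ b, alt s t (m + n) = alt s t m ++ b := by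
  induction m generalizing s t with
  | zero => exact ⟨alt s t (0 + n), rfl⟩
  | succ m ih =>
    obtain ⟨b, hb⟩ := ih t s
    exact ⟨b, by rw [Nat.add_right_comm, alt, hb]; rfl⟩

theorem length_alt (s t : Fin q) (n : ℕ) : (alt s t n).length = n := by
  induction n generalizing s t with
  | zero => rfl
  | succ n ih => simp [alt, ih]

/-- `x` and `y` differ by exchanging the two symbols of an alternating segment of positive
length. Length one, where a single symbol is replaced, is included. -/
def IsAltFlip (x y : List (Fin q)) : Prop :=
  ∃ (a b : List (Fin q)) (s t : Fin q) (n : ℕ), s ≠ t ∧ 1 ≤ n ∧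
    x = a ++ alt s t n ++ b ∧ y = a ++ alt t s n ++ b

theorem IsAltFlip.append_left {x y : List (Fin q)} (h : IsAltFlip x y) (a : List (Fin q)) :
    IsAltFlip (a ++ x) (a ++ y) := by
  obtain ⟨a', b, s, t, n, hst, hn, rfl, rfl⟩ := h
  exact ⟨a ++ a', b, s, t, n, hst, hn, by simp, by simp⟩

theorem exists_first_difference {x y : List (Fin q)} (hne : x ≠ y) (hl : x.length = y.length) :
    ∃ a s t u v, s ≠ t ∧ x = a ++ s :: u ∧ y = a ++ t :: v := by
  induction x generalizing y with
  | nil => exact absurd (List.length_eq_zero_iff.1 hl.symm).symm hne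
  | cons c x ih =>
    rcases y with _ | ⟨d, y⟩
    · simp at hl
    · by_cases hcd : c = d
      · subst hcd
        obtain ⟨a, s, t, u, v, hst, rfl, rfl⟩ := ih (by simpa using hne) (by simpa using hl)
        exact ⟨c :: a, s, t, u, v, hst, rfl, rfl⟩
      · exact ⟨[], c, d, x, y, hcd, rfl, rfl⟩

theorem exists_eq_append_of_mem_deletionBall_append {x y z : List (Fin q)} (hne : x ≠ y)
    (a : List (Fin q)) (hx : z ∈ deletionBall (a ++ x)) (hy : z ∈ deletionBall (a ++ y)) :
    ∃ z', z = a ++ z' ∧ z' ∈ deletionBall x ∧ z' ∈ deletionBall y := by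
  induction a generalizing z with
  | nil => exact ⟨z, rfl, hx, hy⟩
  | cons c a ih =>
    have key : ∃ z', z = c :: z' ∧ z' ∈ deletionBall (a ++ x) ∧ z' ∈ deletionBall (a ++ y) := by
      rw [List.cons_append, mem_deletionBall_cons] at hx hy
      rcases hx with rfl | ⟨z₁, rfl, h₁⟩ <;> rcases hy with h | ⟨z₂, h, h₂⟩
      · exact absurd (List.append_cancel_left h) hne
      · exact ⟨z₂, h, by rw [h, mem_deletionBall_cons]; exact Or.inl rfl, h₂⟩
      · exact ⟨z₁, rfl, h₁, by rw [← h, mem_deletionBall_cons]; exact Or.inl rfl⟩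
      · obtain rfl := (List.cons.inj h).2
        exact ⟨z₁, rfl, h₁, h₂⟩
    obtain ⟨z', rfl, h₁, h₂⟩ := key
    obtain ⟨z'', rfl, h⟩ := ih h₁ h₂
    exact ⟨z'', rfl, h⟩

theorem exists_eq_append_of_mem_insertionBall_append {x y z : List (Fin q)} (hne : x ≠ y)
    (a : List (Fin q)) (hx : z ∈ insertionBall (a ++ x)) (hy : z ∈ insertionBall (a ++ y)) :
    ∃ z', z = a ++ z' ∧ z' ∈ insertionBall x ∧ z' ∈ insertionBall y := by
  induction a generalizing z with
  | nil => exact ⟨z, rfl, hx, hy⟩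
  | cons c a ih =>
    have key : ∃ z', z = c :: z' ∧ z' ∈ insertionBall (a ++ x) ∧ z' ∈ insertionBall (a ++ y) := by
      have self : ∀ w : List (Fin q), c :: w ∈ insertionBall w := fun w =>
        mem_insertionBall_iff.2 ⟨[], c, w, rfl, rfl⟩
      rw [List.cons_append, mem_insertionBall_cons] at hx hy
      rcases hx with ⟨s, rfl⟩ | ⟨z₁, rfl, h₁⟩ <;> rcases hy with ⟨t, h⟩ | ⟨z₂, h, h₂⟩
      · simp [hne] at h
      · obtain ⟨rfl, rfl⟩ := List.cons.inj h
        exact ⟨_, rfl, self _, h₂⟩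
      · obtain ⟨rfl, rfl⟩ := List.cons.inj h
        exact ⟨_, rfl, h₁, self _⟩
      · obtain rfl := (List.cons.inj h).2
        exact ⟨z₁, rfl, h₁, h₂⟩
    obtain ⟨z', rfl, h₁, h₂⟩ := key
    obtain ⟨z'', rfl, h⟩ := ih h₁ h₂
    exact ⟨z'', rfl, h⟩

/-- A common subword cannot start with both `s` and `t`, so the first symbol of one of the two
words is the deleted one. -/
theorem eq_or_eq_of_mem_deletionBall_cons {s t : Fin q} (hst : s ≠ t) {u v z : List (Fin q)}
    (hx : z ∈ deletionBall (s :: u)) (hy : z ∈ deletionBall (t :: v)) : z = u ∨ z = v := by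
  rw [mem_deletionBall_cons] at hx hy
  rcases hx with h | ⟨z₁, rfl, -⟩
  · exact Or.inl h
  · rcases hy with h | ⟨z₂, h, -⟩
    · exact Or.inr h
    · exact absurd (List.cons.inj h).1 hst

theorem eq_or_eq_of_mem_insertionBall_cons {s t : Fin q} (hst : s ≠ t) {u v z : List (Fin q)}
    (hx : z ∈ insertionBall (s :: u)) (hy : z ∈ insertionBall (t :: v)) :
    z = t :: s :: u ∨ z = s :: t :: v := by
  rw [mem_insertionBall_cons] at hx hy
  rcases hx with ⟨c, rfl⟩ | ⟨z₁, rfl, -⟩ <;> rcases hy with ⟨d, h⟩ | ⟨z₂, h, -⟩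
  · simp [hst] at h
  · exact Or.inl (by rw [(List.cons.inj h).1])
  · exact Or.inr (by rw [h, (List.cons.inj h).1])
  · exact absurd (List.cons.inj h).1 hst

theorem isAltFlip_of_mem_deletionBall {s t : Fin q} (hst : s ≠ t) {u v : List (Fin q)}
    (hu : u ∈ deletionBall (t :: v)) (hv : v ∈ deletionBall (s :: u)) :
    ∃ b n, 1 ≤ n ∧ s :: u = alt s t n ++ b ∧ t :: v = alt t s n ++ b := by
  induction u generalizing s t v with
  | nil =>
    rcases mem_deletionBall_cons.1 hv with rfl | ⟨u', rfl, hu'⟩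
    · exact ⟨[], 1, le_rfl, rfl, rfl⟩
    · simp [deletionBall] at hu'
  | cons c u ih =>
    rcases mem_deletionBall_cons.1 hu with h | ⟨v', h, hv'⟩
    · exact ⟨c :: u, 1, le_rfl, rfl, by rw [← h]; rfl⟩
    rcases mem_deletionBall_cons.1 hv with h' | ⟨u', rfl, hu'⟩
    · exact ⟨c :: u, 1, le_rfl, rfl, by rw [h']; rfl⟩
    obtain ⟨rfl, rfl⟩ := List.cons.inj h
    obtain ⟨b, n, -, h₁, h₂⟩ := ih hst.symm hv' hu'
    exact ⟨b, n + 1, by omega, by rw [h₁]; rfl, by rw [h₂]; rfl⟩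

theorem isAltFlip_of_mem_insertionBall {s t : Fin q} (hst : s ≠ t) {u v : List (Fin q)}
    (hu : s :: u ∈ insertionBall v) (hv : t :: v ∈ insertionBall u) :
    ∃ b n, 1 ≤ n ∧ s :: u = alt s t n ++ b ∧ t :: v = alt t s n ++ b := by
  have self : ∀ w : List (Fin q), ∃ b n, 1 ≤ n ∧ s :: w = alt s t n ++ b ∧
      t :: w = alt t s n ++ b := fun w => ⟨w, 1, le_rfl, rfl, rfl⟩
  induction u generalizing s t v with
  | nil =>
    obtain ⟨a, c, b, h, h'⟩ := mem_insertionBall_iff.1 hv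
    obtain ⟨rfl, rfl⟩ := List.append_eq_nil_iff.1 h.symm
    obtain rfl : v = [] := by simpa using (List.cons.inj h').2
    exact self []
  | cons c u ih =>
    rcases v with _ | ⟨d, v⟩
    · obtain ⟨a, e, b, h, h'⟩ := mem_insertionBall_iff.1 hu
      obtain ⟨rfl, rfl⟩ := List.append_eq_nil_iff.1 h.symm
      simp at h'
    rcases mem_insertionBall_cons.1 hu with ⟨e, h⟩ | ⟨v', h, hv'⟩
    · rw [(List.cons.inj h).2]; exact self _
    rcases mem_insertionBall_cons.1 hv with ⟨e, h'⟩ | ⟨u', h', hu'⟩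
    · rw [(List.cons.inj h').2]; exact self _
    obtain ⟨rfl, rfl⟩ := List.cons.inj h
    obtain ⟨rfl, rfl⟩ := List.cons.inj h'
    obtain ⟨b, n, -, h₁, h₂⟩ := ih hst.symm hv' hu' (fun w => ⟨w, 1, le_rfl, rfl, rfl⟩)
    exact ⟨b, n + 1, by omega, by rw [h₁]; rfl, by rw [h₂]; rfl⟩

theorem card_deletionBall_inter_le_two {x y : List (Fin q)} (hne : x ≠ y)
    (hl : x.length = y.length) : (deletionBall x ∩ deletionBall y).card ≤ 2 := by
  obtain ⟨a, s, t, u, v, hst, rfl, rfl⟩ := exists_first_difference hne hl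
  refine (Finset.card_le_card ?_).trans (Finset.card_le_two (a := a ++ u) (b := a ++ v))
  intro z hz
  obtain ⟨z', rfl, h₁, h₂⟩ := exists_eq_append_of_mem_deletionBall_append (by simp [hst]) a
    (Finset.mem_inter.1 hz).1 (Finset.mem_inter.1 hz).2
  rcases eq_or_eq_of_mem_deletionBall_cons hst h₁ h₂ with rfl | rfl <;> simp

theorem card_insertionBall_inter_le_two {x y : List (Fin q)} (hne : x ≠ y)
    (hl : x.length = y.length) : (insertionBall x ∩ insertionBall y).card ≤ 2 := by
  obtain ⟨a, s, t, u, v, hst, rfl, rfl⟩ := exists_first_difference hne hl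
  refine (Finset.card_le_card ?_).trans
    (Finset.card_le_two (a := a ++ t :: s :: u) (b := a ++ s :: t :: v))
  intro z hz
  obtain ⟨z', rfl, h₁, h₂⟩ := exists_eq_append_of_mem_insertionBall_append (by simp [hst]) a
    (Finset.mem_inter.1 hz).1 (Finset.mem_inter.1 hz).2
  rcases eq_or_eq_of_mem_insertionBall_cons hst h₁ h₂ with rfl | rfl <;> simp

theorem isAltFlip_of_one_lt_card_deletionBall_inter {x y : List (Fin q)} (hne : x ≠ y)
    (hl : x.length = y.length) (hc : 1 < (deletionBall x ∩ deletionBall y).card) :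
    IsAltFlip x y := by
  obtain ⟨a, s, t, u, v, hst, rfl, rfl⟩ := exists_first_difference hne hl
  obtain ⟨z₁, hz₁, z₂, hz₂, hz⟩ := Finset.one_lt_card.1 hc
  have strip := fun z (hz : z ∈ deletionBall (a ++ s :: u) ∩ deletionBall (a ++ t :: v)) =>
    exists_eq_append_of_mem_deletionBall_append (by simp [hst]) a
      (Finset.mem_inter.1 hz).1 (Finset.mem_inter.1 hz).2
  obtain ⟨z₁, rfl, h₁, h₁'⟩ := strip z₁ hz₁
  obtain ⟨z₂, rfl, h₂, h₂'⟩ := strip z₂ hz₂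
  have key : u ∈ deletionBall (t :: v) ∧ v ∈ deletionBall (s :: u) := by
    rcases eq_or_eq_of_mem_deletionBall_cons hst h₁ h₁' with rfl | rfl <;>
    rcases eq_or_eq_of_mem_deletionBall_cons hst h₂ h₂' with rfl | rfl
    · exact absurd rfl hz
    · exact ⟨h₁', h₂⟩
    · exact ⟨h₂', h₁⟩
    · exact absurd rfl hz
  obtain ⟨b, n, hn, h, h'⟩ := isAltFlip_of_mem_deletionBall hst key.1 key.2
  exact ⟨a, b, s, t, n, hst, hn, by rw [h, List.append_assoc], by rw [h', List.append_assoc]⟩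

theorem isAltFlip_of_one_lt_card_insertionBall_inter {x y : List (Fin q)} (hne : x ≠ y)
    (hl : x.length = y.length) (hc : 1 < (insertionBall x ∩ insertionBall y).card) :
    IsAltFlip x y := by
  obtain ⟨a, s, t, u, v, hst, rfl, rfl⟩ := exists_first_difference hne hl
  obtain ⟨z₁, hz₁, z₂, hz₂, hz⟩ := Finset.one_lt_card.1 hc
  have strip := fun z (hz : z ∈ insertionBall (a ++ s :: u) ∩ insertionBall (a ++ t :: v)) =>
    exists_eq_append_of_mem_insertionBall_append (by simp [hst]) a
      (Finset.mem_inter.1 hz).1 (Finset.mem_inter.1 hz).2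
  obtain ⟨z₁, rfl, h₁, h₁'⟩ := strip z₁ hz₁
  obtain ⟨z₂, rfl, h₂, h₂'⟩ := strip z₂ hz₂
  have key : t :: s :: u ∈ insertionBall (t :: v) ∧ s :: t :: v ∈ insertionBall (s :: u) := by
    rcases eq_or_eq_of_mem_insertionBall_cons hst h₁ h₁' with rfl | rfl <;>
    rcases eq_or_eq_of_mem_insertionBall_cons hst h₂ h₂' with rfl | rfl
    · exact absurd rfl hz
    · exact ⟨h₁', h₂⟩
    · exact ⟨h₂', h₁⟩
    · exact absurd rfl hz
  have hu : s :: u ∈ insertionBall v := by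
    rcases mem_insertionBall_cons.1 key.1 with ⟨c, h⟩ | ⟨z', h, hz'⟩
    · simp [hst] at h
    · rwa [(List.cons.inj h).2]
  have hv : t :: v ∈ insertionBall u := by
    rcases mem_insertionBall_cons.1 key.2 with ⟨c, h⟩ | ⟨z', h, hz'⟩
    · simp [hst.symm] at h
    · rwa [(List.cons.inj h).2]
  obtain ⟨b, n, hn, h, h'⟩ := isAltFlip_of_mem_insertionBall hst hu hv
  exact ⟨a, b, s, t, n, hst, hn, by rw [h, List.append_assoc], by rw [h', List.append_assoc]⟩

/-! ### Type-A-confusable words -/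

theorem wordPow_succ (w : List (Fin q)) (m : ℕ) : wordPow w (m + 1) = w ++ wordPow w m := by
  simp [wordPow, List.replicate_succ]

theorem wordPow_add (w : List (Fin q)) (m n : ℕ) :
    wordPow w (m + n) = wordPow w m ++ wordPow w n := by
  rw [wordPow, List.replicate_add, List.flatten_append]; rfl

theorem wordPow_pair (s t : Fin q) (m : ℕ) : wordPow [s, t] m = alt s t (2 * m) := by
  induction m with
  | zero => rfl
  | succ m ih => rw [wordPow_succ, ih]; rfl

theorem wordPow_pair_append (s t : Fin q) (m : ℕ) :
    wordPow [s, t] m ++ [s] = alt s t (2 * m + 1) := by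
  induction m with
  | zero => rfl
  | succ m ih => rw [wordPow_succ, List.append_assoc, ih]; rfl

theorem map_swap_alt (s t : Fin q) (n : ℕ) : (alt s t n).map (Equiv.swap s t) = alt t s n := by
  induction n generalizing s t with
  | zero => rfl
  | succ n ih => rw [alt, List.map_cons, Equiv.swap_comm, ih, Equiv.swap_apply_right]; rfl

theorem TypeAConfusable.exists_alt {x y : List (Fin q)} (h : TypeAConfusable x y) :
    ∃ (a b : List (Fin q)) (s t : Fin q) (n : ℕ), s ≠ t ∧
      x = a ++ (alt s t (n + 2) ++ b) ∧ y = a ++ (alt t s (n + 2) ++ b) := by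
  obtain ⟨a, b, c, s, t, m, hst, hm, hc, rfl, rfl⟩ := h
  obtain ⟨k, rfl⟩ := Nat.exists_eq_add_of_le' hm
  rw [wordPow_pair_append, wordPow_pair] at hc
  rcases hc with rfl | rfl
  · exact ⟨a, b, s, t, 2 * k, hst, by simp [mul_add], by simp [map_swap_alt, mul_add]⟩
  · exact ⟨a, b, s, t, 2 * k + 1, hst, by simp [mul_add],
      by simp [map_swap_alt, mul_add]⟩

theorem TypeAConfusable.one_lt_card_deletionBall_inter {x y : List (Fin q)}
    (h : TypeAConfusable x y) : 1 < (deletionBall x ∩ deletionBall y).card := by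
  obtain ⟨a, b, s, t, n, hst, rfl, rfl⟩ := h.exists_alt
  -- deleting the first symbol of an alternating word is deleting the last symbol of its flip
  have key : ∀ s t : Fin q, a ++ (alt s t (n + 1) ++ b) ∈
      deletionBall (a ++ (alt s t (n + 2) ++ b)) ∩ deletionBall (a ++ (alt t s (n + 2) ++ b)) := by
    intro s t
    obtain ⟨p, hp⟩ := alt_succ_eq_append s t (n + 1)
    rw [Finset.mem_inter, mem_deletionBall_iff, mem_deletionBall_iff]
    exact ⟨⟨a ++ alt s t (n + 1), p, b, by rw [hp]; simp, by simp⟩,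
      ⟨a, t, alt s t (n + 1) ++ b, rfl, rfl⟩⟩
  refine Finset.one_lt_card.2 ⟨_, key s t, _, by rw [Finset.inter_comm]; exact key t s, ?_⟩
  simp [alt, hst]

theorem TypeAConfusable.one_lt_card_insertionBall_inter {x y : List (Fin q)}
    (h : TypeAConfusable x y) : 1 < (insertionBall x ∩ insertionBall y).card := by
  obtain ⟨a, b, s, t, n, hst, rfl, rfl⟩ := h.exists_alt
  have key : ∀ s t : Fin q, a ++ (alt s t (n + 3) ++ b) ∈
      insertionBall (a ++ (alt s t (n + 2) ++ b)) ∩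
        insertionBall (a ++ (alt t s (n + 2) ++ b)) := by
    intro s t
    obtain ⟨p, hp⟩ := alt_succ_eq_append s t (n + 2)
    rw [Finset.mem_inter, mem_insertionBall_iff, mem_insertionBall_iff]
    exact ⟨⟨a ++ alt s t (n + 2), p, b, by simp, by rw [hp]; simp⟩,
      ⟨a, s, alt t s (n + 2) ++ b, rfl, rfl⟩⟩
  refine Finset.one_lt_card.2 ⟨_, key s t, _, by rw [Finset.inter_comm]; exact key t s, ?_⟩
  simp [alt, hst]

/-! ### Counting words and bounding the redundancy -/

/-- The set `Σ_q^n` of all words of length `n`. -/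
def words (q n : ℕ) : Finset (List (Fin q)) :=
  (Finset.univ : Finset (List.Vector (Fin q) n)).image List.Vector.toList

theorem mem_words {n : ℕ} {x : List (Fin q)} : x ∈ words q n ↔ x.length = n := by
  simp only [words, Finset.mem_image, Finset.mem_univ, true_and]
  exact ⟨by rintro ⟨v, rfl⟩; exact v.toList_length, fun h => ⟨⟨x, h⟩, rfl⟩⟩

theorem card_words (q n : ℕ) : (words q n).card = q ^ n := by
  rw [words, Finset.card_image_of_injective _ List.Vector.toList_injective, Finset.card_univ,
    card_vector, Fintype.card_fin]

theorem IsCode.card_le {n : ℕ} {C : Finset (List (Fin q))} (hC : IsCode n C) :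
    C.card ≤ q ^ n := by
  rw [← card_words]
  exact Finset.card_le_card fun x hx => mem_words.2 (hC x hx)

theorem readCoverage_lt_iff {B : List (Fin q) → Finset (List (Fin q))}
    {C : Finset (List (Fin q))} {N : ℕ} (hN : 0 < N) :
    readCoverage B C < N ↔ ∀ x ∈ C, ∀ y ∈ C, x ≠ y → (B x ∩ B y).card < N := by
  rw [readCoverage, Finset.sup_lt_iff (by simpa using hN)]
  simp only [Finset.mem_offDiag, Prod.forall]
  exact ⟨fun h x hx y hy hxy => h x y ⟨hx, hy, hxy⟩, fun h x y hxy => h x hxy.1 y hxy.2.1 hxy.2.2⟩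

theorem codeRedundancy_le (hq : 2 ≤ q) {n : ℕ} {C : Finset (List (Fin q))} (hne : C.Nonempty)
    {K : ℝ} (hK : (q : ℝ) ^ n ≤ K * C.card) : codeRedundancy n C ≤ Real.logb q K := by
  have hq1 : (1 : ℝ) < q := by exact_mod_cast hq
  have hC : (0 : ℝ) < C.card := by exact_mod_cast hne.card_pos
  have hqn : (0 : ℝ) < (q : ℝ) ^ n := by positivity
  have hK0 : 0 < K := pos_of_mul_pos_left (hqn.trans_le hK) hC.le
  have h := Real.logb_le_logb_of_le hq1 hqn hK
  rw [Real.logb_mul hK0.ne' hC.ne', Real.logb_pow, Real.logb_self_eq_one hq1, mul_one] at h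
  unfold codeRedundancy
  linarith

theorem le_codeRedundancy (hq : 2 ≤ q) {n : ℕ} {C : Finset (List (Fin q))} (hne : C.Nonempty)
    {K : ℝ} (hK0 : 0 < K) (hK : K * C.card ≤ (q : ℝ) ^ n) :
    Real.logb q K ≤ codeRedundancy n C := by
  have hq1 : (1 : ℝ) < q := by exact_mod_cast hq
  have hC : (0 : ℝ) < C.card := by exact_mod_cast hne.card_pos
  have h := Real.logb_le_logb_of_le hq1 (by positivity) hK
  rw [Real.logb_mul hK0.ne' hC.ne', Real.logb_pow, Real.logb_self_eq_one hq1, mul_one] at h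
  unfold codeRedundancy
  linarith

theorem rho_le (hq : 2 ≤ q) {n N : ℕ} (hN : 1 ≤ N) {B : List (Fin q) → Finset (List (Fin q))}
    {C : Finset (List (Fin q))} (hne : C.Nonempty) (hC : IsReconstructionCode n N B C)
    {K : ℝ} (hK : (q : ℝ) ^ n ≤ K * C.card) : rho n N B ≤ Real.logb q K :=
  ((rho_isLeast (by omega) hN B).2 ⟨C, hne, hC, rfl⟩).trans (codeRedundancy_le hq hne hK)

theorem le_rho (hq : 2 ≤ q) {n N : ℕ} (hN : 1 ≤ N) {B : List (Fin q) → Finset (List (Fin q))}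
    {r : ℝ} (h : ∀ C : Finset (List (Fin q)), C.Nonempty → IsReconstructionCode n N B C →
      r ≤ codeRedundancy n C) : r ≤ rho n N B := by
  obtain ⟨C, hne, hC, hr⟩ := (rho_isLeast (n := n) (by omega) hN B).1
  rw [hr]
  exact h C hne hC

/-- One fibre of `f` on `S` has at least the average size. -/
theorem exists_large_fiber {T : Type*} [Fintype T] [DecidableEq T] {S : Finset (List (Fin q))}
    (hS : S.Nonempty) (f : List (Fin q) → T) :
    ∃ y, (S.filter fun x => f x = y).Nonempty ∧
      S.card ≤ Fintype.card T * (S.filter fun x => f x = y).card := by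
  have hT : (Finset.univ : Finset T).Nonempty := ⟨f hS.choose, Finset.mem_univ _⟩
  obtain ⟨y, -, hy⟩ := Finset.exists_max_image Finset.univ
    (fun y => (S.filter fun x => f x = y).card) hT
  have h := Finset.card_le_mul_card_image_of_maps_to (s := S) (f := f) (t := Finset.univ)
    (fun _ _ => Finset.mem_univ _) _ hy
  rw [mul_comm, Finset.card_univ] at h
  refine ⟨y, Finset.card_pos.1 (Nat.pos_of_ne_zero fun h0 => ?_), h⟩
  rw [h0, mul_zero] at h
  exact hS.card_pos.ne' (Nat.le_zero.1 h)

/-! ### Varshamov–Tenengolts sums -/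

/-- The symbols of a word, as integers. -/
def toInt (x : List (Fin q)) : List ℤ := x.map fun c => ((c : ℕ) : ℤ)

/-- The sum of the entries of a list, each weighted by its position counted from the right. -/
def vt : List ℤ → ℤ
  | [] => 0
  | c :: l => c * (l.length + 1) + vt l

theorem vt_append (l l' : List ℤ) : vt (l ++ l') = vt l + l'.length * l.sum + vt l' := by
  induction l with
  | nil => simp [vt]
  | cons c l ih => simp only [List.cons_append, vt, ih, List.length_append, List.sum_cons]
                   push_cast; ring

theorem toInt_cons (c : Fin q) (x : List (Fin q)) : toInt (c :: x) = ((c : ℕ) : ℤ) :: toInt x :=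
  rfl

theorem toInt_append (x y : List (Fin q)) : toInt (x ++ y) = toInt x ++ toInt y := by
  simp [toInt]

theorem length_toInt (x : List (Fin q)) : (toInt x).length = x.length := by
  simp [toInt]

/-- The sum of the symbols of a word modulo `q`. -/
def symbolSum (x : List (Fin q)) : ZMod q := ((toInt x).sum : ℤ)

theorem eq_of_dvd_sub {s t : Fin q} (h : (q : ℤ) ∣ ((s : ℕ) : ℤ) - ((t : ℕ) : ℤ)) : s = t := by
  have := Int.eq_zero_of_abs_lt_dvd h (by rw [abs_lt]; omega)
  exact Fin.ext (by omega)

theorem exists_of_isShift_of_symbolSum_eq {x y : List (Fin q)} (h : IsShift x y)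
    (hs : symbolSum x = symbolSum y) : ∃ a w b s, x = a ++ s :: (w ++ b) ∧
      y = a ++ (w ++ s :: b) := by
  obtain ⟨a, w, b, s, t, rfl, rfl⟩ := h
  rw [eq_comm, symbolSum, symbolSum, ZMod.intCast_eq_intCast_iff_dvd_sub] at hs
  simp only [toInt_append, toInt_cons, List.sum_append, List.sum_cons] at hs
  obtain rfl : s = t := eq_of_dvd_sub (by convert hs using 1; ring)
  exact ⟨a, w, b, s, rfl, rfl⟩

theorem eq_replicate_of_sum (w : List (Fin 2)) :
    0 ≤ (toInt w).sum ∧ (toInt w).sum ≤ w.length ∧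
      ((toInt w).sum = 0 → w = List.replicate w.length 0) ∧
      ((toInt w).sum = w.length → w = List.replicate w.length 1) := by
  induction w with
  | nil => simp [toInt]
  | cons c w ih =>
    obtain ⟨h0, h1, h2, h3⟩ := ih
    simp only [toInt_cons, List.sum_cons, List.length_cons, List.replicate_succ, List.cons.injEq]
    push_cast
    fin_cases c <;> simp only
    · simp only [Nat.cast_zero, zero_add]
      exact ⟨h0, by omega, fun h => ⟨rfl, h2 h⟩, fun h => by omega⟩
    · simp only [Nat.cast_one]
      exact ⟨by omega, by omega, fun h => by omega, fun h => ⟨rfl, h3 (by omega)⟩⟩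

theorem cons_replicate_append {α : Type*} (s : α) (n : ℕ) (b : List α) :
    s :: (List.replicate n s ++ b) = List.replicate n s ++ s :: b := by
  rw [← List.singleton_append (l := b), ← List.append_assoc, ← List.replicate_succ',
    List.replicate_succ, List.cons_append]

/-- Moving a bit `s` past a binary word `w` changes the weighted sum by the number of bits of `w`
that differ from `s`, so a change of `0` modulo `M ≥ |x|` means that `s` stays in its run. -/
theorem eq_of_isShift_of_vt_eq {M : ℕ} {x y : List (Fin 2)} (h : IsShift x y)
    (hs : symbolSum x = symbolSum y) (hv : (vt (toInt x) : ZMod M) = vt (toInt y))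
    (hl : x.length ≤ M) : x = y := by
  obtain ⟨a, w, b, s, rfl, rfl⟩ := exists_of_isShift_of_symbolSum_eq h hs
  rw [eq_comm, ZMod.intCast_eq_intCast_iff_dvd_sub] at hv
  simp only [toInt_append, toInt_cons, vt_append, vt,
    List.length_append, List.length_cons, length_toInt] at hv
  have hv' : (M : ℤ) ∣ ((s : ℕ) : ℤ) * w.length - (toInt w).sum := by
    convert hv using 1
    push_cast
    ring
  simp only [List.length_append, List.length_cons] at hl
  obtain ⟨h0, h1, h2, h3⟩ := eq_replicate_of_sum w
  have hw : w = List.replicate w.length s := by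
    fin_cases s
    · simp only [Nat.cast_zero, zero_mul, zero_sub] at hv'
      exact h2 (neg_eq_zero.1 (Int.eq_zero_of_abs_lt_dvd hv' (by rw [abs_lt]; omega)))
    · simp only [Nat.cast_one, one_mul] at hv'
      have := Int.eq_zero_of_abs_lt_dvd hv' (by rw [abs_lt]; omega)
      exact h3 (by omega)
  rw [hw, cons_replicate_append]

/-! ### Codes for one read -/

/-- The binary word that marks the weak ascents of `x`. -/
def ascents : List (Fin q) → List (Fin 2)
  | [] => []
  | [_] => []
  | c :: d :: x => (if c ≤ d then 1 else 0) :: ascents (d :: x)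

theorem length_ascents (x : List (Fin q)) : (ascents x).length = x.length - 1 := by
  induction x with
  | nil => rfl
  | cons c x ih =>
    rcases x with _ | ⟨d, x⟩
    · rfl
    · simp [ascents, ih]

theorem ascents_mem_deletionBall {x z : List (Fin q)} (h : z ∈ deletionBall x) (hz : z ≠ []) :
    ascents z ∈ deletionBall (ascents x) := by
  induction x generalizing z with
  | nil => simp [deletionBall] at h
  | cons c x ih =>
    rcases mem_deletionBall_cons.1 h with rfl | ⟨z, rfl, hm⟩
    · obtain ⟨d, x, rfl⟩ := List.exists_cons_of_ne_nil hz
      exact mem_deletionBall_cons.2 (Or.inl rfl)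
    · rcases x with _ | ⟨d, x⟩
      · simp [deletionBall] at hm
      rcases z with _ | ⟨e, z⟩
      · obtain rfl : x = [] := by
          rcases mem_deletionBall_cons.1 hm with h₀ | ⟨_, h₀, -⟩
          · exact h₀.symm
          · simp at h₀
        exact mem_deletionBall_cons.2 (Or.inl rfl)
      rcases mem_deletionBall_cons.1 hm with rfl | ⟨z', hz', h'⟩
      · -- when `d` is deleted from `c d e`, one of its two comparisons equals that of `c` and `e`
        simp only [ascents]
        by_cases h₁ : c ≤ d <;> by_cases h₂ : d ≤ e
        · rw [if_pos h₁, if_pos h₂, if_pos (h₁.trans h₂)]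
          exact mem_deletionBall_cons.2 (Or.inl rfl)
        · rw [if_pos h₁, if_neg h₂, mem_deletionBall_cons]
          by_cases h₃ : c ≤ e
          · exact Or.inr ⟨_, by rw [if_pos h₃], mem_deletionBall_cons.2 (Or.inl rfl)⟩
          · exact Or.inl (by rw [if_neg h₃])
        · rw [if_neg h₁, if_pos h₂, mem_deletionBall_cons]
          by_cases h₃ : c ≤ e
          · exact Or.inl (by rw [if_pos h₃])
          · exact Or.inr ⟨_, by rw [if_neg h₃], mem_deletionBall_cons.2 (Or.inl rfl)⟩
        · have h₃ : ¬ c ≤ e := fun h₃ => h₁ (h₃.trans (not_le.1 h₂).le)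
          rw [if_neg h₁, if_neg h₂, if_neg h₃]
          exact mem_deletionBall_cons.2 (Or.inl rfl)
      · obtain ⟨rfl, rfl⟩ := List.cons.inj hz'
        exact mem_deletionBall_cons.2 (Or.inr ⟨_, rfl, ih hm (by simp)⟩)

theorem ascents_append_left_cancel (a : List (Fin q)) {x y : List (Fin q)}
    (h : ascents (a ++ x) = ascents (a ++ y)) : ascents x = ascents y := by
  induction a with
  | nil => exact h
  | cons c a ih =>
    refine ih ?_
    rw [List.cons_append, List.cons_append] at h
    generalize a ++ x = x' at h
    generalize a ++ y = y' at h
    rcases x' with _ | ⟨d, x'⟩ <;> rcases y' with _ | ⟨e, y'⟩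
    · rfl
    · simp [ascents] at h
    · simp [ascents] at h
    · exact (List.cons.inj h).2

/-- If a shift across `c w` preserves the ascents, then all comparisons along
`e, c, w, t` have the same outcome. -/
theorem monotone_or_lt_of_ascents_eq (b : List (Fin q)) (t : Fin q) (w : List (Fin q))
    (e c : Fin q) (h : ascents (e :: c :: (w ++ b)) = ascents (c :: (w ++ t :: b))) :
    (e ≤ c ∧ c ≤ t ∧ ∀ d ∈ w, e ≤ d ∧ d ≤ t) ∨ (c < e ∧ t < c) := by
  induction w generalizing e c with
  | nil =>
    simp only [List.nil_append, ascents, List.cons.injEq] at h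
    by_cases h₁ : e ≤ c <;> by_cases h₂ : c ≤ t
    · exact Or.inl ⟨h₁, h₂, by simp⟩
    · simp [h₁, h₂] at h
    · simp [h₁, h₂] at h
    · exact Or.inr ⟨not_le.1 h₁, not_le.1 h₂⟩
  | cons d w ih =>
    rw [List.cons_append, List.cons_append, ascents] at h
    replace h := List.cons.inj (h.trans (ascents.eq_3 c d _))
    obtain ⟨h₀, h⟩ := h
    rcases ih c d h with ⟨h₁, h₂, h₃⟩ | ⟨h₁, h₂⟩
    · have hec : e ≤ c := by
        by_contra hec
        simp [hec, h₁] at h₀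
      refine Or.inl ⟨hec, h₁.trans h₂, ?_⟩
      intro f hf
      rcases List.mem_cons.1 hf with rfl | hf
      · exact ⟨hec.trans h₁, h₂⟩
      · exact ⟨hec.trans (h₃ f hf).1, (h₃ f hf).2⟩
    · have hec : ¬ e ≤ c := by
        intro hec
        simp [hec, not_le.2 h₁] at h₀
      exact Or.inr ⟨not_le.1 hec, h₂.trans h₁⟩

theorem eq_of_shift_of_ascents_eq {a w b : List (Fin q)} {s : Fin q}
    (h : ascents (a ++ s :: (w ++ b)) = ascents (a ++ (w ++ s :: b))) :
    a ++ s :: (w ++ b) = a ++ (w ++ s :: b) := by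
  have h := ascents_append_left_cancel a h
  rcases w with _ | ⟨c, w⟩
  · rfl
  rcases monotone_or_lt_of_ascents_eq b s w s c h with ⟨h₁, h₂, h₃⟩ | ⟨h₁, h₂⟩
  · obtain rfl := le_antisymm h₁ h₂
    have hw : w = List.replicate w.length s :=
      List.eq_replicate_iff.2 ⟨rfl, fun d hd => le_antisymm (h₃ d hd).2 (h₃ d hd).1⟩
    rw [hw, List.cons_append, List.cons_append, cons_replicate_append]
  · exact absurd h₁ h₂.asymm

/-- Tenengolts' invariant: the sum of the symbols modulo `q`, together with the parity and the
weighted sum modulo `n` of the ascent word. -/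
def tenengolts (n : ℕ) (x : List (Fin q)) : ZMod q × ZMod 2 × ZMod n :=
  (symbolSum x, symbolSum (ascents x), (vt (toInt (ascents x)) : ℤ))

theorem eq_of_isShift_of_tenengolts_eq {n : ℕ} {x y : List (Fin q)} (h : IsShift x y)
    (hx : x.length = n) (hy : y.length = n) (hxy : tenengolts n x = tenengolts n y) : x = y := by
  obtain ⟨h₁, h₂⟩ := Prod.ext_iff.1 hxy
  obtain ⟨h₂, h₃⟩ := Prod.ext_iff.1 h₂
  obtain ⟨a, w, b, s, rfl, rfl⟩ := exists_of_isShift_of_symbolSum_eq h h₁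
  by_cases hz : a ++ (w ++ b) = []
  · obtain ⟨rfl, hwb⟩ := List.append_eq_nil_iff.1 hz
    obtain ⟨rfl, rfl⟩ := List.append_eq_nil_iff.1 hwb
    rfl
  have hzx := ascents_mem_deletionBall (mem_deletionBall_iff.2 ⟨a, s, w ++ b, rfl, rfl⟩) hz
  have hzy := ascents_mem_deletionBall
    (mem_deletionBall_iff.2 ⟨a ++ w, s, b, (List.append_assoc _ _ _).symm, by simp⟩) hz
  apply eq_of_shift_of_ascents_eq
  rcases isShift_or_isShift_of_mem_deletionBall hzx hzy with h | h
  · exact eq_of_isShift_of_vt_eq h h₂ h₃ (by rw [length_ascents]; omega)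
  · exact (eq_of_isShift_of_vt_eq h h₂.symm h₃.symm (by rw [length_ascents]; omega)).symm

/-! ### Codes for two reads -/

theorem sum_toInt_alt_two_mul (s t : Fin q) (k : ℕ) :
    (toInt (alt s t (2 * k))).sum = k * (((s : ℕ) : ℤ) + ((t : ℕ) : ℤ)) := by
  induction k with
  | zero => simp [alt, toInt]
  | succ k ih =>
    rw [mul_add, mul_one, alt, alt, toInt_cons, toInt_cons, List.sum_cons, List.sum_cons, ih]
    push_cast; ring

theorem vt_alt_sub (s t : Fin q) (k : ℕ) :
    vt (toInt (alt s t (2 * k))) - vt (toInt (alt t s (2 * k))) =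
      k * (((s : ℕ) : ℤ) - ((t : ℕ) : ℤ)) := by
  induction k with
  | zero => simp [alt, toInt]
  | succ k ih =>
    simp only [mul_add, mul_one, alt, toInt_cons, vt, List.length_cons, length_toInt, length_alt]
    push_cast
    linarith

/-- Flipping an alternating segment of odd length changes the sum of the symbols by a nonzero
amount less than `q`, and flipping one of even length `2 k` keeps this sum and changes the weighted
sum by a nonzero amount less than `q k`. -/
theorem false_of_alt_flip_of_invariants_eq {m n : ℕ} {a b : List (Fin q)} {s t : Fin q}
    (hst : s ≠ t) (hn : 1 ≤ n) (hnm : n < m)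
    (hs : symbolSum (a ++ alt s t n ++ b) = symbolSum (a ++ alt t s n ++ b))
    (hv : (vt (toInt (a ++ alt s t n ++ b)) : ZMod (q * m)) =
      vt (toInt (a ++ alt t s n ++ b))) : False := by
  rw [eq_comm, symbolSum, symbolSum, ZMod.intCast_eq_intCast_iff_dvd_sub] at hs
  rw [eq_comm, ZMod.intCast_eq_intCast_iff_dvd_sub] at hv
  rcases Nat.even_or_odd' n with ⟨k, rfl | rfl⟩
  · simp only [toInt_append, vt_append, List.sum_append, length_toInt, length_alt,
      sum_toInt_alt_two_mul] at hv
    have hd : ((q * m : ℕ) : ℤ) ∣ k * (((s : ℕ) : ℤ) - ((t : ℕ) : ℤ)) := by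
      rw [← vt_alt_sub]
      convert hv using 1
      ring
    have hlt : |(k : ℤ) * (((s : ℕ) : ℤ) - ((t : ℕ) : ℤ))| < ((q * m : ℕ) : ℤ) := by
      have h1 : |((s : ℕ) : ℤ) - ((t : ℕ) : ℤ)| < q := by rw [abs_lt]; omega
      rw [abs_mul, Nat.abs_cast, Nat.cast_mul, mul_comm]
      have h2 : (k : ℤ) < m := by omega
      exact mul_lt_mul h1 h2.le (by omega) (by omega)
    have h0 := Int.eq_zero_of_abs_lt_dvd hd hlt
    rcases mul_eq_zero.1 h0 with h | h
    · omega
    · exact hst (Fin.ext (by omega))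
  · simp only [toInt_append, alt, toInt_cons, List.sum_append, List.sum_cons,
      sum_toInt_alt_two_mul] at hs
    exact hst (eq_of_dvd_sub (by convert hs using 1; ring))

open Classical in
/-- The words of length `n` without an alternating segment of length `m`. (Constant segments are
excluded as well.) -/
noncomputable def shortAltWords (q n m : ℕ) : Finset (List (Fin q)) :=
  (words q n).filter fun x => ¬ ∃ a s t b, x = a ++ (alt s t m ++ b)

theorem mem_shortAltWords {n m : ℕ} {x : List (Fin q)} :
    x ∈ shortAltWords q n m ↔ x.length = n ∧ ¬ ∃ a s t b, x = a ++ (alt s t m ++ b) := by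
  classical
  simp only [shortAltWords, Finset.mem_filter, mem_words]

/-- A union bound over the position of the segment and its two symbols. -/
theorem card_words_le_two_mul_card_shortAltWords {n m : ℕ} (hm : 1 ≤ m)
    (h : 2 * n * q ^ 2 ≤ q ^ m) : q ^ n ≤ 2 * (shortAltWords q n m).card := by
  classical
  have hsplit := Finset.card_filter_add_card_filter_not (s := words q n)
    (fun x => ∃ a s t b, x = a ++ (alt s t m ++ b))
  rw [card_words] at hsplit
  have hbad : 2 * ((words q n).filter fun x => ∃ a s t b, x = a ++ (alt s t m ++ b)).card ≤
      q ^ n := by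
    rcases lt_or_ge n m with hnm | hnm
    · rw [Finset.filter_false_of_mem]
      · simp
      · rintro x hx ⟨a, s, t, b, rfl⟩
        rw [mem_words] at hx
        simp only [List.length_append, length_alt] at hx
        omega
    · have hsub : ((words q n).filter fun x => ∃ a s t b, x = a ++ (alt s t m ++ b)) ⊆
          (words q (n - m) ×ˢ Finset.range n ×ˢ
            (Finset.univ : Finset (Fin q)) ×ˢ (Finset.univ : Finset (Fin q))).image
            fun p => p.1.take p.2.1 ++ (alt p.2.2.1 p.2.2.2 m ++ p.1.drop p.2.1) := by
        intro x hx
        obtain ⟨hx, a, s, t, b, rfl⟩ := Finset.mem_filter.1 hx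
        rw [mem_words] at hx
        simp only [List.length_append, length_alt] at hx
        refine Finset.mem_image.2 ⟨(a ++ b, a.length, s, t), ?_, by simp⟩
        simp only [Finset.mem_product, mem_words, Finset.mem_range, Finset.mem_univ, and_true,
          List.length_append]
        omega
      have hcard := (Finset.card_le_card hsub).trans Finset.card_image_le
      simp only [Finset.card_product, card_words, Finset.card_range, Finset.card_univ,
        Fintype.card_fin] at hcard
      calc _ ≤ 2 * (q ^ (n - m) * (n * (q * q))) := Nat.mul_le_mul_left 2 hcard
        _ = q ^ (n - m) * (2 * n * q ^ 2) := by ring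
        _ ≤ q ^ (n - m) * q ^ m := Nat.mul_le_mul_left _ h
        _ = q ^ n := by rw [← pow_add, Nat.sub_add_cancel hnm]
  unfold shortAltWords
  omega

/-! ### Codes without Type-A-confusable pairs -/

theorem TypeAConfusable.ne {x y : List (Fin q)} (h : TypeAConfusable x y) : x ≠ y := by
  obtain ⟨a, b, s, t, n, hst, rfl, rfl⟩ := h.exists_alt
  simp [alt, hst]

theorem TypeAConfusable.append_left {x y : List (Fin q)} (h : TypeAConfusable x y)
    (p : List (Fin q)) : TypeAConfusable (p ++ x) (p ++ y) := by
  obtain ⟨a, b, c, s, t, m, hst, hm, hc, rfl, rfl⟩ := h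
  exact ⟨p ++ a, b, c, s, t, m, hst, hm, hc, by simp, by simp⟩

/-- The words `(t s)^j (s t)^(k-j)`, for `j = 0, …, k`. Any two of them are Type-A-confusable. -/
def switchWord (s t : Fin q) (k j : ℕ) : List (Fin q) :=
  wordPow [t, s] j ++ wordPow [s, t] (k - j)

theorem length_switchWord (s t : Fin q) {k j : ℕ} (h : j ≤ k) :
    (switchWord s t k j).length = 2 * k := by
  rw [switchWord, wordPow_pair, wordPow_pair, List.length_append, length_alt, length_alt]
  omega

theorem typeAConfusable_switchWord {s t : Fin q} (hst : s ≠ t) {k i j : ℕ} (hij : i < j)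
    (hjk : j ≤ k) (b : List (Fin q)) :
    TypeAConfusable (switchWord s t k i ++ b) (switchWord s t k j ++ b) := by
  refine ⟨wordPow [t, s] i, wordPow [s, t] (k - j) ++ b, wordPow [s, t] (j - i), s, t, j - i, hst,
    by omega, Or.inl rfl, ?_, ?_⟩
  · rw [switchWord, show k - i = (j - i) + (k - j) by omega, wordPow_add]
    simp
  · rw [wordPow_pair s t, map_swap_alt, ← wordPow_pair, ← wordPow_add, switchWord,
      Nat.add_sub_cancel' hij.le, List.append_assoc]

theorem card_image_switchWord {s t : Fin q} (hst : s ≠ t) (k : ℕ) :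
    ((Finset.range (k + 1)).image (switchWord s t k)).card = k + 1 := by
  rw [Finset.card_image_of_injOn, Finset.card_range]
  intro i hi j hj hij
  simp only [Finset.coe_range, Set.mem_Iio] at hi hj
  by_contra hne
  rcases Nat.lt_or_gt_of_ne hne with h | h
  · exact (typeAConfusable_switchWord hst h (Nat.lt_succ_iff.1 hj) []).ne (by rw [hij])
  · exact (typeAConfusable_switchWord hst h (Nat.lt_succ_iff.1 hi) []).ne (by rw [hij])

/-- The words of a code without Type-A-confusable pairs that start with a switch word are
determined by the rest. -/
theorem card_filter_switchWord_le {n k : ℕ} {s t : Fin q} (hst : s ≠ t)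
    {C : Finset (List (Fin q))} (hC : IsCode (2 * k + n) C) (hA : TypeAFree C) :
    (C.filter fun x => x.take (2 * k) ∈ (Finset.range (k + 1)).image (switchWord s t k)).card ≤
      q ^ n := by
  rw [← card_words]
  refine Finset.card_le_card_of_injOn (fun x => x.drop (2 * k)) ?_ ?_
  · intro x hx
    have := hC x (Finset.mem_filter.1 hx).1
    simp [mem_words, this]
  · intro x hx y hy hxy
    obtain ⟨hx, hx'⟩ := Finset.mem_filter.1 hx
    obtain ⟨hy, hy'⟩ := Finset.mem_filter.1 hy
    obtain ⟨i, hi, hi'⟩ := Finset.mem_image.1 hx'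
    obtain ⟨j, hj, hj'⟩ := Finset.mem_image.1 hy'
    rw [Finset.mem_range] at hi hj
    simp only at hxy
    have ex : x = switchWord s t k i ++ x.drop (2 * k) := by rw [hi', List.take_append_drop]
    have ey : y = switchWord s t k j ++ x.drop (2 * k) := by
      rw [hj', hxy, List.take_append_drop]
    rcases Nat.lt_trichotomy i j with h | rfl | h
    · have := typeAConfusable_switchWord hst h (Nat.lt_succ_iff.1 hj) (x.drop (2 * k))
      rw [← ex, ← ey] at this
      exact absurd this (hA x hx y hy this.ne)
    · rw [ex, ← ey]
    · have := typeAConfusable_switchWord hst h (Nat.lt_succ_iff.1 hi) (x.drop (2 * k))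
      rw [← ex, ← ey] at this
      exact absurd this (hA y hy x hx this.ne)

/-- Induction on the number `m` of blocks of length `2 k`: the words whose first block is a switch
word contribute at most `1 / q^(2 k)` to the density of the code, and after each of the other
`q^(2 k) - (k + 1)` blocks there follows a code of the same kind. -/
theorem card_le_of_typeAFree (hq : 2 ≤ q) (k r m : ℕ) (C : Finset (List (Fin q)))
    (hC : IsCode (m * (2 * k) + r) C) (hA : TypeAFree C) :
    (C.card : ℝ) ≤ (q : ℝ) ^ (m * (2 * k) + r) *
      (1 / ((k : ℝ) + 1) + (1 - ((k : ℝ) + 1) / (q : ℝ) ^ (2 * k)) ^ m) := by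
  induction m generalizing C with
  | zero =>
    have h := hC.card_le
    have h' : (C.card : ℝ) ≤ (q : ℝ) ^ (0 * (2 * k) + r) := by exact_mod_cast h
    refine h'.trans (le_mul_of_one_le_right (by positivity) ?_)
    rw [pow_zero]
    have : (0 : ℝ) ≤ 1 / ((k : ℝ) + 1) := by positivity
    linarith
  | succ m ih =>
    set n := m * (2 * k) + r with hn
    have hlen : (m + 1) * (2 * k) + r = 2 * k + n := by rw [hn]; ring
    rw [hlen] at hC ⊢
    set g : ℝ := 1 / ((k : ℝ) + 1) + (1 - ((k : ℝ) + 1) / (q : ℝ) ^ (2 * k)) ^ m with hg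
    have hst : (⟨0, by omega⟩ : Fin q) ≠ ⟨1, by omega⟩ := by simp
    set S := (Finset.range (k + 1)).image (switchWord (⟨0, by omega⟩ : Fin q) ⟨1, by omega⟩ k)
      with hS
    have hScard : S.card = k + 1 := card_image_switchWord hst k
    have hSsub : S ⊆ words q (2 * k) := by
      intro x hx
      obtain ⟨j, hj, rfl⟩ := Finset.mem_image.1 hx
      exact mem_words.2 (length_switchWord _ _ (by simpa [Nat.lt_succ_iff] using hj))
    have hfirst := card_filter_switchWord_le hst hC hA
    rw [← hS] at hfirst
    have hmaps : ∀ x ∈ C.filter (fun x => ¬ x.take (2 * k) ∈ S),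
        x.take (2 * k) ∈ words q (2 * k) \ S := by
      intro x hx
      obtain ⟨hx, hx'⟩ := Finset.mem_filter.1 hx
      refine Finset.mem_sdiff.2 ⟨mem_words.2 ?_, hx'⟩
      rw [List.length_take, hC x hx]
      omega
    have hrest := Finset.card_eq_sum_card_fiberwise hmaps
    have hfib : ∀ p ∈ words q (2 * k) \ S,
        (((C.filter fun x => ¬ x.take (2 * k) ∈ S).filter fun x => x.take (2 * k) = p).card : ℝ) ≤
          (q : ℝ) ^ n * g := by
      intro p _
      set D := (C.filter fun x => ¬ x.take (2 * k) ∈ S).filter fun x => x.take (2 * k) = p with hD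
      have hDC : ∀ x ∈ D, x ∈ C ∧ x = p ++ x.drop (2 * k) := by
        intro x hx
        obtain ⟨hx, hp⟩ := Finset.mem_filter.1 hx
        exact ⟨(Finset.mem_filter.1 hx).1, by rw [← hp, List.take_append_drop]⟩
      rw [← Finset.card_image_of_injOn (f := fun x => x.drop (2 * k)) (s := D)]
      · apply ih
        · intro z hz
          obtain ⟨x, hx, rfl⟩ := Finset.mem_image.1 hz
          rw [List.length_drop, hC x (hDC x hx).1]
          omega
        · intro z hz z' hz' hne hzz
          obtain ⟨x, hx, rfl⟩ := Finset.mem_image.1 hz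
          obtain ⟨x', hx', rfl⟩ := Finset.mem_image.1 hz'
          have h := hzz.append_left p
          rw [← (hDC x hx).2, ← (hDC x' hx').2] at h
          exact hA x (hDC x hx).1 x' (hDC x' hx').1 h.ne h
      · intro x hx x' hx' h
        simp only at h
        rw [(hDC x hx).2, (hDC x' hx').2, h]
    have hrest' : ((C.filter fun x => ¬ x.take (2 * k) ∈ S).card : ℝ) ≤
        ((q : ℝ) ^ (2 * k) - (k + 1)) * ((q : ℝ) ^ n * g) := by
      rw [hrest, Nat.cast_sum]
      refine (Finset.sum_le_card_nsmul _ _ _ hfib).trans_eq ?_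
      rw [nsmul_eq_mul, Finset.cast_card_sdiff hSsub, hScard, card_words]
      push_cast
      ring
    have hsum := Finset.card_filter_add_card_filter_not (s := C) (fun x => x.take (2 * k) ∈ S)
    have hfirst' : ((C.filter fun x => x.take (2 * k) ∈ S).card : ℝ) ≤ (q : ℝ) ^ n := by
      exact_mod_cast hfirst
    have hQ : (0 : ℝ) < (q : ℝ) ^ (2 * k) := by positivity
    have hk : (0 : ℝ) < (k : ℝ) + 1 := by positivity
    rw [← hsum, Nat.cast_add]
    refine (add_le_add hfirst' hrest').trans_eq ?_
    rw [pow_succ, hg, pow_add]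
    field_simp
    ring

/-- The blocks have length about `(log_q n) / 2`, and there are about `√n` of them. -/
theorem logb_mul_card_le_of_typeAFree (hq : 2 ≤ q) {n : ℕ} (hn : 1 ≤ n)
    {C : Finset (List (Fin q))} (hC : IsCode n C) (hA : TypeAFree C) :
    Real.logb q n / 8 * C.card ≤ (q : ℝ) ^ n := by
  have hq1 : (1 : ℝ) < q := by exact_mod_cast hq
  set L := Nat.log q n with hL
  set k := L / 4 with hk
  have hlog : Real.logb q n ≤ 4 * ((k : ℝ) + 1) := by
    have h1 : Real.logb q n ≤ ((L + 1 : ℕ) : ℝ) := by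
      rw [Real.logb_le_iff_le_rpow hq1 (by exact_mod_cast hn), Real.rpow_natCast]
      exact_mod_cast (Nat.lt_pow_succ_log_self hq n).le
    refine h1.trans ?_
    have : L + 1 ≤ 4 * (k + 1) := by omega
    exact_mod_cast this
  have hpow : q ^ (2 * k) * (2 * k) ≤ n := by
    calc q ^ (2 * k) * (2 * k) ≤ q ^ (2 * k) * q ^ (2 * k) :=
          Nat.mul_le_mul_left _ (Nat.lt_pow_self hq).le
      _ = q ^ (4 * k) := by rw [← pow_add]; congr 1; ring
      _ ≤ q ^ L := Nat.pow_le_pow_right (by omega) (by omega)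
      _ ≤ n := Nat.pow_log_le_self q (by omega)
  obtain ⟨r, hr⟩ := Nat.exists_eq_add_of_le hpow
  have h := card_le_of_typeAFree hq k r (q ^ (2 * k)) C (by rwa [← hr]) hA
  rw [← hr] at h
  have hk1 : (0 : ℝ) < (k : ℝ) + 1 := by positivity
  have hQ : (0 : ℝ) < (q : ℝ) ^ (2 * k) := by positivity
  have hle : ((k : ℝ) + 1) / (q : ℝ) ^ (2 * k) ≤ 1 := by
    rw [div_le_one hQ]
    rcases Nat.eq_zero_or_pos k with h0 | h0
    · simp [h0]
    · have : k + 1 ≤ q ^ (2 * k) := by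
        have := Nat.lt_pow_self hq (n := 2 * k)
        omega
      exact_mod_cast this
  have hdecay : (1 - ((k : ℝ) + 1) / (q : ℝ) ^ (2 * k)) ^ (q ^ (2 * k)) ≤ 1 / ((k : ℝ) + 1) := by
    calc (1 - ((k : ℝ) + 1) / (q : ℝ) ^ (2 * k)) ^ (q ^ (2 * k))
        ≤ Real.exp (-(((k : ℝ) + 1) / (q : ℝ) ^ (2 * k))) ^ (q ^ (2 * k)) :=
          pow_le_pow_left₀ (by linarith) (Real.one_sub_le_exp_neg _) _
      _ = (Real.exp ((k : ℝ) + 1))⁻¹ := by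
          rw [← Real.exp_nat_mul, ← Real.exp_neg]
          congr 1
          push_cast
          field_simp
      _ ≤ 1 / ((k : ℝ) + 1) := by
          rw [one_div]
          refine inv_anti₀ hk1 ?_
          have := Real.add_one_le_exp ((k : ℝ) + 1)
          linarith
  have hqn : (0 : ℝ) < (q : ℝ) ^ n := by positivity
  calc Real.logb q n / 8 * C.card ≤ 4 * ((k : ℝ) + 1) / 8 * C.card :=
        mul_le_mul_of_nonneg_right (by linarith) (Nat.cast_nonneg _)
    _ ≤ 4 * ((k : ℝ) + 1) / 8 * ((q : ℝ) ^ n * (1 / ((k : ℝ) + 1) + 1 / ((k : ℝ) + 1))) := by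
        gcongr
        exact h.trans (by gcongr)
    _ = (q : ℝ) ^ n := by field_simp; ring

/-! ### The optimal redundancies -/

variable {B : List (Fin q) → Finset (List (Fin q))}

theorem isShift_or_isShift_of_mem_inter (hB : B = deletionBall ∨ B = insertionBall)
    {x y z : List (Fin q)} (hne : x ≠ y) (hz : z ∈ B x ∩ B y) : IsShift x y ∨ IsShift y x := by
  obtain ⟨hx, hy⟩ := Finset.mem_inter.1 hz
  rcases hB with rfl | rfl
  · exact isShift_or_isShift_of_mem_deletionBall hx hy
  · exact isShift_or_isShift_of_mem_insertionBall hne hx hy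

theorem isAltFlip_of_one_lt_card_inter (hB : B = deletionBall ∨ B = insertionBall)
    {x y : List (Fin q)} (hne : x ≠ y) (hl : x.length = y.length)
    (hc : 1 < (B x ∩ B y).card) : IsAltFlip x y := by
  rcases hB with rfl | rfl
  · exact isAltFlip_of_one_lt_card_deletionBall_inter hne hl hc
  · exact isAltFlip_of_one_lt_card_insertionBall_inter hne hl hc

theorem IsReconstructionCode.typeAFree (hB : B = deletionBall ∨ B = insertionBall) {n : ℕ}
    {C : Finset (List (Fin q))} (hC : IsReconstructionCode n 2 B C) : TypeAFree C := by
  intro x hx y hy hne h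
  have h2 := (readCoverage_lt_iff two_pos).1 hC.2 x hx y hy hne
  rcases hB with rfl | rfl
  · have := h.one_lt_card_deletionBall_inter
    omega
  · have := h.one_lt_card_insertionBall_inter
    omega

/-- For either kind of ball, the insertion balls around the codewords are disjoint. -/
theorem IsReconstructionCode.mul_card_le (hq : 2 ≤ q)
    (hB : B = deletionBall ∨ B = insertionBall) {n : ℕ} {C : Finset (List (Fin q))}
    (hC : IsReconstructionCode n 1 B C) : n * C.card ≤ q ^ (n + 1) := by
  have hdisj : ∀ x ∈ C, ∀ y ∈ C, x ≠ y → Disjoint (insertionBall x) (insertionBall y) := by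
    intro x hx y hy hne
    have h1 := (readCoverage_lt_iff one_pos).1 hC.2 x hx y hy hne
    rw [Nat.lt_one_iff, Finset.card_eq_zero] at h1
    rw [Finset.disjoint_left]
    intro z hzx hzy
    rcases hB with rfl | rfl
    · have : ∃ z, z ∈ deletionBall x ∧ z ∈ deletionBall y := by
        rcases isShift_or_isShift_of_mem_insertionBall hne hzx hzy with h | h
        · exact h.exists_mem_deletionBall
        · obtain ⟨z, h₁, h₂⟩ := h.exists_mem_deletionBall
          exact ⟨z, h₂, h₁⟩
      obtain ⟨z, h₁, h₂⟩ := this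
      exact Finset.notMem_empty z (h1 ▸ Finset.mem_inter.2 ⟨h₁, h₂⟩)
    · exact Finset.notMem_empty z (h1 ▸ Finset.mem_inter.2 ⟨hzx, hzy⟩)
  have hsub : C.biUnion insertionBall ⊆ words q (n + 1) := by
    intro z hz
    obtain ⟨x, hx, hz⟩ := Finset.mem_biUnion.1 hz
    obtain ⟨a, s, b, rfl, rfl⟩ := mem_insertionBall_iff.1 hz
    have := hC.1 _ hx
    rw [mem_words]
    simp only [List.length_append, List.length_cons] at this ⊢
    omega
  have hle := Finset.card_le_card hsub
  rw [Finset.card_biUnion hdisj, card_words] at hle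
  refine le_trans ?_ hle
  rw [mul_comm, ← smul_eq_mul]
  exact Finset.card_nsmul_le_sum _ _ _ fun x hx =>
    (hC.1 x hx).symm.trans_le (length_le_card_insertionBall hq x)

theorem logb_sub_one_le_rho_one (hq : 2 ≤ q) (hB : B = deletionBall ∨ B = insertionBall) {n : ℕ}
    (hn : 1 ≤ n) : Real.logb q n - 1 ≤ rho n 1 B := by
  have hq1 : (1 : ℝ) < q := by exact_mod_cast hq
  have hn0 : (0 : ℝ) < n := by exact_mod_cast hn
  have hq0 : (0 : ℝ) < q := by linarith
  refine le_rho hq le_rfl fun C hne hC => ?_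
  have h : (n : ℝ) * C.card ≤ (q : ℝ) ^ (n + 1) := by
    exact_mod_cast hC.mul_card_le hq hB
  have := le_codeRedundancy hq hne (K := n / q) (by positivity)
    (by rw [div_mul_eq_mul_div, div_le_iff₀ hq0, ← pow_succ]; exact h)
  rwa [Real.logb_div hn0.ne' hq0.ne', Real.logb_self_eq_one hq1] at this

theorem rho_one_le (hq : 2 ≤ q) (hB : B = deletionBall ∨ B = insertionBall) {n : ℕ}
    (hn : 1 ≤ n) : rho n 1 B ≤ Real.logb q n + Real.logb q (2 * q) := by
  have : NeZero q := ⟨by omega⟩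
  have : NeZero n := ⟨by omega⟩
  have hne : (words q n).Nonempty := by
    rw [← Finset.card_pos, card_words]
    positivity
  obtain ⟨y, hCne, hcard⟩ := exists_large_fiber hne (tenengolts n)
  rw [Fintype.card_prod, Fintype.card_prod, ZMod.card, ZMod.card, ZMod.card, card_words] at hcard
  have hcode : IsReconstructionCode n 1 B ((words q n).filter fun x => tenengolts n x = y) := by
    refine ⟨fun x hx => mem_words.1 (Finset.mem_filter.1 hx).1, ?_⟩
    rw [readCoverage_lt_iff one_pos]
    intro x hx x' hx' hxx
    rw [Nat.lt_one_iff, Finset.card_eq_zero, Finset.eq_empty_iff_forall_notMem]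
    intro z hz
    obtain ⟨hxn, rfl⟩ := Finset.mem_filter.1 hx
    obtain ⟨hxn', h'⟩ := Finset.mem_filter.1 hx'
    rw [mem_words] at hxn hxn'
    rcases isShift_or_isShift_of_mem_inter hB hxx hz with h | h
    · exact hxx (eq_of_isShift_of_tenengolts_eq h hxn hxn' h'.symm)
    · exact hxx (eq_of_isShift_of_tenengolts_eq h hxn' hxn h').symm
  have hn0 : (0 : ℝ) < n := by exact_mod_cast hn
  have hq0 : (0 : ℝ) < q := by exact_mod_cast (by omega : 0 < q)
  rw [← Real.logb_mul hn0.ne' (by positivity)]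
  refine rho_le hq le_rfl hCne hcode ?_
  have h : (q : ℝ) ^ n ≤ (q * (2 * n) : ℕ) *
      (((words q n).filter fun x => tenengolts n x = y).card : ℝ) := by
    exact_mod_cast hcard
  refine h.trans_eq ?_
  push_cast
  ring

theorem rho_two_le (hq : 2 ≤ q) (hB : B = deletionBall ∨ B = insertionBall) {n : ℕ}
    (hn : 2 ≤ n) : rho n 2 B ≤ Real.logb q (Real.logb q n) +
      Real.logb q (2 * q ^ 2 * (1 + 4 / Real.logb q 2)) := by
  have hq1 : (1 : ℝ) < q := by exact_mod_cast hq
  have : NeZero q := ⟨by omega⟩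
  -- `m` is so large that at most half of all words have an alternating segment of length `m`
  set m := Nat.log q n + 4 with hm
  have : NeZero (q * m) := ⟨(Nat.mul_pos (by omega) (by omega)).ne'⟩
  have hqm : 2 * n * q ^ 2 ≤ q ^ m := by
    calc 2 * n * q ^ 2 ≤ q * q ^ (Nat.log q n + 1) * q ^ 2 := by
          gcongr
          exact (Nat.lt_pow_succ_log_self hq n).le
      _ = q ^ m := by rw [hm]; ring
  have hgood := card_words_le_two_mul_card_shortAltWords (by omega) hqm
  have hne : (shortAltWords q n m).Nonempty := by
    rw [← Finset.card_pos]
    have : 0 < q ^ n := by positivity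
    omega
  obtain ⟨y, hCne, hcard⟩ := exists_large_fiber hne
    (fun x => ((symbolSum x, ((vt (toInt x) : ℤ) : ZMod (q * m))) : ZMod q × ZMod (q * m)))
  rw [Fintype.card_prod, ZMod.card, ZMod.card] at hcard
  set C := (shortAltWords q n m).filter fun x =>
    ((symbolSum x, ((vt (toInt x) : ℤ) : ZMod (q * m))) : ZMod q × ZMod (q * m)) = y with hC
  have hlen : ∀ x ∈ C, x.length = n := fun x hx =>
    (mem_shortAltWords.1 (Finset.mem_filter.1 hx).1).1
  have hcode : IsReconstructionCode n 2 B C := by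
    refine ⟨hlen, ?_⟩
    rw [readCoverage_lt_iff two_pos]
    intro x hx x' hx' hxx
    by_contra hcon
    have hinv : ((symbolSum x, ((vt (toInt x) : ℤ) : ZMod (q * m))) : ZMod q × ZMod (q * m)) =
        (symbolSum x', ((vt (toInt x') : ℤ) : ZMod (q * m))) :=
      (Finset.mem_filter.1 hx).2.trans (Finset.mem_filter.1 hx').2.symm
    have hshort := (mem_shortAltWords.1 (Finset.mem_filter.1 hx).1).2
    obtain ⟨a, b, s, t, l, hst, hl, rfl, rfl⟩ :=
      isAltFlip_of_one_lt_card_inter hB hxx ((hlen x hx).trans (hlen x' hx').symm) (by omega)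
    have hlm : l < m := by
      by_contra hlm
      obtain ⟨j, rfl⟩ := Nat.exists_eq_add_of_le (not_lt.1 hlm)
      obtain ⟨b', hb'⟩ := alt_add s t m j
      exact hshort ⟨a, s, t, b' ++ b, by rw [hb']; simp⟩
    exact false_of_alt_flip_of_invariants_eq hst hl hlm (Prod.ext_iff.1 hinv).1
      (Prod.ext_iff.1 hinv).2
  have hq0 : (0 : ℝ) < q := by linarith
  have hlog2 : 0 < Real.logb q 2 := Real.logb_pos hq1 one_lt_two
  have hlog2n : Real.logb q 2 ≤ Real.logb q n :=
    Real.logb_le_logb_of_le hq1 two_pos (by exact_mod_cast hn)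
  have hlogn : 0 < Real.logb q n := hlog2.trans_le hlog2n
  have hmle : (m : ℝ) ≤ Real.logb q n * (1 + 4 / Real.logb q 2) := by
    have h1 : ((Nat.log q n : ℕ) : ℝ) ≤ Real.logb q n := Real.natLog_le_logb n q
    have h2 : 4 ≤ Real.logb q n * (4 / Real.logb q 2) := by
      rw [mul_div_assoc', le_div_iff₀ hlog2]
      linarith
    rw [hm]
    push_cast
    linarith
  rw [← Real.logb_mul hlogn.ne' (by positivity)]
  refine rho_le hq one_le_two hCne hcode ?_
  have h : (q : ℝ) ^ n ≤ (2 * (q * (q * m)) : ℕ) * (C.card : ℝ) := by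
    have : q ^ n ≤ 2 * (q * (q * m)) * C.card := by
      rw [mul_assoc]
      exact hgood.trans (Nat.mul_le_mul_left 2 hcard)
    exact_mod_cast this
  calc (q : ℝ) ^ n ≤ (2 * (q * (q * m)) : ℕ) * (C.card : ℝ) := h
    _ = 2 * q ^ 2 * m * C.card := by push_cast; ring
    _ ≤ 2 * q ^ 2 * (Real.logb q n * (1 + 4 / Real.logb q 2)) * C.card := by gcongr
    _ = _ := by ring

theorem logb_logb_sub_le_codeRedundancy (hq : 2 ≤ q) {n : ℕ} (hn : 2 ≤ n)
    {C : Finset (List (Fin q))} (hne : C.Nonempty) (hC : IsCode n C) (hA : TypeAFree C) :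
    Real.logb q (Real.logb q n) - Real.logb q 8 ≤ codeRedundancy n C := by
  have hq1 : (1 : ℝ) < q := by exact_mod_cast hq
  have hlogn : 0 < Real.logb q n := Real.logb_pos hq1 (by exact_mod_cast hn)
  rw [← Real.logb_div hlogn.ne' (by norm_num)]
  exact le_codeRedundancy hq hne (by positivity)
    (logb_mul_card_le_of_typeAFree hq (by omega) hC hA)

/-- Three reads suffice for the code of all words. -/
theorem rho_eq_zero (hq : 2 ≤ q) (hB : B = deletionBall ∨ B = insertionBall) {n N : ℕ}
    (hN : 3 ≤ N) : rho n N B = 0 := by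
  apply le_antisymm
  · have hne : (words q n).Nonempty := by
      rw [← Finset.card_pos, card_words]
      positivity
    have hcode : IsReconstructionCode n N B (words q n) := by
      refine ⟨fun x hx => mem_words.1 hx, ?_⟩
      rw [readCoverage_lt_iff (by omega)]
      intro x hx y hy hxy
      have hl := (mem_words.1 hx).trans (mem_words.1 hy).symm
      refine lt_of_le_of_lt ?_ hN
      rcases hB with rfl | rfl
      · exact card_deletionBall_inter_le_two hxy hl
      · exact card_insertionBall_inter_le_two hxy hl
    have := rho_le hq (by omega) hne hcode (K := 1) (by rw [card_words]; simp)
    rwa [Real.logb_one] at this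
  · refine le_rho hq (by omega) fun C hne hC => ?_
    have h : (1 : ℝ) * C.card ≤ (q : ℝ) ^ n := by
      rw [one_mul]
      exact_mod_cast hC.1.card_le
    simpa using le_codeRedundancy hq hne one_pos h

end Reconstruction

theorem mainTheorem8 (q : ℕ) (hq : 2 ≤ q) (B : List (Fin q) → Finset (List (Fin q)))
    (hB : B = Reconstruction.deletionBall ∨ B = Reconstruction.insertionBall) :
    -- `N = 1`
    (∃ ε : ℕ → ℝ, ε =Θ[atTop] (fun _ => (1 : ℝ)) ∧ ∀ n : ℕ, 1 ≤ n →
      Real.logb (q : ℝ) (n : ℝ) - ε n ≤ Reconstruction.rho n 1 B ∧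
      Reconstruction.rho n 1 B ≤ Real.logb (q : ℝ) (n : ℝ) + ε n) ∧
    -- `N = 2`
    (∃ ε : ℕ → ℝ, ε =Θ[atTop] (fun _ => (1 : ℝ)) ∧ ∀ n : ℕ, 2 ≤ n →
      Real.logb (q : ℝ) (Real.logb (q : ℝ) (n : ℝ)) - ε n ≤ Reconstruction.rho n 2 B ∧
      Reconstruction.rho n 2 B ≤ Real.logb (q : ℝ) (Real.logb (q : ℝ) (n : ℝ)) + ε n) ∧
    -- `N ≥ 3`
    (∀ n N : ℕ, 3 ≤ N → Reconstruction.rho n N B = 0) ∧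
    -- the lower bound for `N = 2` holds for all codes without Type-A-confusable pairs,
    -- and every reconstruction code for two reads is such a code
    ((∀ (n : ℕ) (C : Finset (List (Fin q))),
        Reconstruction.IsReconstructionCode n 2 B C → Reconstruction.TypeAFree C) ∧
      (∃ ε : ℕ → ℝ, ε =Θ[atTop] (fun _ => (1 : ℝ)) ∧
        ∀ n : ℕ, 2 ≤ n → ∀ C : Finset (List (Fin q)), C.Nonempty →
          Reconstruction.IsCode n C → Reconstruction.TypeAFree C →
          Real.logb (q : ℝ) (Real.logb (q : ℝ) (n : ℝ)) - ε n ≤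
            Reconstruction.codeRedundancy n C)) := by
  have hq1 : (1 : ℝ) < q := by exact_mod_cast hq
  have hlog2 : 0 < Real.logb q 2 := Real.logb_pos hq1 one_lt_two
  have h8 : 0 < Real.logb q 8 := Real.logb_pos hq1 (by norm_num)
  have hK₁ : 0 < Real.logb q (2 * q) := Real.logb_pos hq1 (by linarith)
  have hK₂ : 0 < Real.logb q (2 * q ^ 2 * (1 + 4 / Real.logb q 2)) := by
    refine Real.logb_pos hq1 ?_
    have h₁ : 1 ≤ 1 + 4 / Real.logb q 2 := le_add_of_nonneg_right (by positivity)
    have h₂ : (1 : ℝ) ≤ (q : ℝ) ^ 2 := one_le_pow₀ hq1.le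
    nlinarith
  refine ⟨⟨fun _ => 1 + Real.logb q (2 * q), ?_, fun n hn => ⟨?_, ?_⟩⟩,
    ⟨fun _ => Real.logb q 8 + Real.logb q (2 * q ^ 2 * (1 + 4 / Real.logb q 2)), ?_,
      fun n hn => ⟨?_, ?_⟩⟩,
    fun n N hN => Reconstruction.rho_eq_zero hq hB hN,
    fun n C hC => hC.typeAFree hB,
    fun _ => Real.logb q 8, ?_, fun n hn C hne hC hA =>
      Reconstruction.logb_logb_sub_le_codeRedundancy hq hn hne hC hA⟩
  · exact isTheta_const_const (by positivity) one_ne_zero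
  · have := Reconstruction.logb_sub_one_le_rho_one hq hB hn
    linarith
  · have := Reconstruction.rho_one_le hq hB hn
    linarith
  · exact isTheta_const_const (by positivity) one_ne_zero
  · refine Reconstruction.le_rho hq one_le_two fun C hne hC => ?_
    have := Reconstruction.logb_logb_sub_le_codeRedundancy hq hn hne hC.1 (hC.typeAFree hB)
    linarith
  · have := Reconstruction.rho_two_le hq hB hn
    linarith
  · exact isTheta_const_const h8.ne' one_ne_zero
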